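/- **Theorem.** Let $n\geqslant 2$ and $X=(x_1,\ldots,x_n)$. For $i\geqslant 0$ let $\widetilde{Q}_i(X)=e_i(X)$ be the $i$-th elementary symmetric polynomial, for $i\geqslant j\geqslant 0$ let $$\widetilde{Q}_{i,j}(X)=\widetilde{Q}_i(X)\widetilde{Q}_j(X)+2\sum_{k=1}^{j}(-1)^k\,\widetilde{Q}_{i+k}(X)\,\widetilde{Q}_{j-k}(X),$$ and for a partition $\lambda=(\lambda_1\geqslant\cdots\geqslant\lambda_r\geqslant 0)$ with $r$ even (add a part $\lambda_r=0$ if necessary) let $\widetilde{Q}_\lambda(X)=\mathrm{Pfaffian}[\widetilde{Q}_{\lambda_i,\lambda_j}(X)]_{1\leqslant i<j\leqslant r}$. Define operators on $\mathbb{Z}[X]$ by $\partial_0 f=(f-s_0f)/(2x_1)$ and $\partial_1' f=(f-s_1f)/(x_2-x_1)$, where $s_0$ replaces $x_1$ by $-x_1$ and $s_1$ interchanges $x_1$ and $x_2$, and set $$\mathfrak{C}''_\lambda(X)=\partial_0\,\partial_1'\,\partial_0\bigl(\widetilde{Q}_\lambda(X)\bigr).$$ Let $\mathcal{D}_n$ be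 the set of strict partitions (all nonzero parts distinct) with $\lambda_1\leqslant n$; the length of $\lambda$ is the number of its nonzero parts, and $\lambda\smallsetminus\mu$ is the partition whose parts are the parts of $\lambda$ that are not parts of $\mu$. Then for every $\lambda=(\lambda_1>\cdots>\lambda_\ell>0)\in\mathcal{D}_n$ of even length $\ell\geqslant 4$, $$\sum_{j=1}^{\ell-1}(-1)^{j-1}\,\mathfrak{C}''_{\lambda_j,\lambda_\ell}(X)\;\mathfrak{C}''_{\lambda\smallsetminus\{\lambda_j,\lambda_\ell\}}(X)=0 .$$ -/

import Mathlib

namespace LagrangianPfaffian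

open MvPolynomial

/-! ### Divided difference operators on `ℤ[x_k : k ∈ σ]` -/

section DividedDifferences

variable {σ : Type*}

/-- If a ring endomorphism `s` fixes every variable modulo `d`, it fixes every polynomial
modulo `d`. -/
theorem dvd_sub_of_dvd_X (d : MvPolynomial σ ℤ)
    (s : MvPolynomial σ ℤ →ₐ[ℤ] MvPolynomial σ ℤ) (h : ∀ k, d ∣ X k - s (X k))
    (f : MvPolynomial σ ℤ) : d ∣ f - s f := by
  have key : Ideal.Quotient.mkₐ ℤ (Ideal.span {d})
      = (Ideal.Quotient.mkₐ ℤ (Ideal.span {d})).comp s := by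
    apply MvPolynomial.algHom_ext
    intro k
    exact Ideal.Quotient.eq.mpr (Ideal.mem_span_singleton.mpr (h k))
  exact Ideal.mem_span_singleton.mp (Ideal.Quotient.eq.mp (DFunLike.congr_fun key f))

variable [DecidableEq σ]

/-- The sign change `x_i ↦ -x_i`, all other variables being fixed. -/
noncomputable def signChange (i : σ) : MvPolynomial σ ℤ →ₐ[ℤ] MvPolynomial σ ℤ :=
  aeval fun k => if k = i then -X i else X k

/-- The interchange of `x_i` and `x_j`, all other variables being fixed. -/
noncomputable def swapVars (i j : σ) : MvPolynomial σ ℤ →ₐ[ℤ] MvPolynomial σ ℤ :=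
  rename (Equiv.swap i j)

theorem signChange_dvd (i : σ) (f : MvPolynomial σ ℤ) : 2 * X i ∣ f - signChange i f := by
  apply dvd_sub_of_dvd_X
  intro k
  by_cases hk : k = i
  · subst hk
    exact ⟨1, by simp [signChange]; ring⟩
  · simp [signChange, hk]

theorem swapVars_dvd (i j : σ) (f : MvPolynomial σ ℤ) :
    X j - X i ∣ f - swapVars i j f := by
  apply dvd_sub_of_dvd_X
  intro k
  by_cases hi : k = i
  · subst hi
    exact ⟨-1, by simp [swapVars]⟩
  · by_cases hj : k = j
    · subst hj
      exact ⟨1, by simp [swapVars]⟩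
    · simp [swapVars, Equiv.swap_apply_of_ne_of_ne hi hj]

/-- `(f - s f) / (2 x_i)`, where `s` changes the sign of `x_i`. The quotient is exact
(`signChange_dvd`), and unique because the polynomial ring is a domain. -/
noncomputable def divDiffSign (i : σ) (f : MvPolynomial σ ℤ) : MvPolynomial σ ℤ :=
  Classical.choose (signChange_dvd i f)

/-- `(f - s f) / (x_j - x_i)`, where `s` interchanges `x_i` and `x_j`. The quotient is exact
(`swapVars_dvd`), and unique if `i ≠ j` because the polynomial ring is a domain. -/
noncomputable def divDiffSwap (i j : σ) (f : MvPolynomial σ ℤ) : MvPolynomial σ ℤ :=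
  Classical.choose (swapVars_dvd i j f)

theorem divDiffSign_spec (i : σ) (f : MvPolynomial σ ℤ) :
    f - signChange i f = 2 * X i * divDiffSign i f :=
  Classical.choose_spec (signChange_dvd i f)

theorem divDiffSwap_spec (i j : σ) (f : MvPolynomial σ ℤ) :
    f - swapVars i j f = (X j - X i) * divDiffSwap i j f :=
  Classical.choose_spec (swapVars_dvd i j f)

end DividedDifferences

/-! ### Pfaffians -/

/-- The Pfaffian of the skew-symmetric `2m × 2m` array whose entries above the diagonal are
`A i j`, `i < j`, by expansion along the first row. Only the entries with `i < j` are used. -/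
def pfaffian {R : Type*} [CommRing R] :
    (m : ℕ) → (Fin (2 * m) → Fin (2 * m) → R) → R
  | 0, _ => 1
  | m + 1, A => ∑ j : Fin (2 * m + 1), (-1) ^ (j : ℕ) * A 0 j.succ *
      pfaffian m fun a b => A (j.succAbove a).succ (j.succAbove b).succ

/-! ### Strict partitions -/

/-- `lam` is (the list of nonzero parts of) a strict partition with largest part at most `n`. -/
def IsStrictPartition (n : ℕ) (lam : List ℕ) : Prop :=
  lam.Pairwise (· > ·) ∧ ∀ a ∈ lam, 1 ≤ a ∧ a ≤ n

/-- The `k`-th part of `lam`, counted from `k = 1`; it is `0` beyond the length. -/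
def part (lam : List ℕ) (k : ℕ) : ℕ := lam.getD (k - 1) 0

/-- The partition whose parts are the parts of `lam` that are not parts of `mu`. -/
def remove (lam mu : List ℕ) : List ℕ := lam.filter fun a => a ∉ mu

/-! ### `Q̃`-polynomials in `x_1, …, x_n`; the variable `x_k` is `X ⟨k - 1, _⟩` -/

/-- `Q̃_i(X) = e_i(x_1, …, x_n)`. -/
noncomputable def Qtilde1 (n i : ℕ) : MvPolynomial (Fin n) ℤ := esymm (Fin n) ℤ i

/-- `Q̃_{i,j}(X)` for `i ≥ j ≥ 0`. -/
noncomputable def Qtilde2 (n i j : ℕ) : MvPolynomial (Fin n) ℤ :=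
  Qtilde1 n i * Qtilde1 n j +
    2 * ∑ k ∈ Finset.Icc 1 j, (-1) ^ k * (Qtilde1 n (i + k) * Qtilde1 n (j - k))

/-- `Q̃_λ(X)`, the Pfaffian of `Q̃_{λ_i,λ_j}(X)`, `1 ≤ i < j ≤ r`, where `r` is the least even
number that is at least the length of `λ` (so `λ_r = 0` if the length is odd). -/
noncomputable def Qtilde (n : ℕ) (lam : List ℕ) : MvPolynomial (Fin n) ℤ :=
  pfaffian ((lam.length + 1) / 2) fun i j =>
    Qtilde2 n (part lam ((i : ℕ) + 1)) (part lam ((j : ℕ) + 1))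

/-- `∂₀`, with `∂₀ f = (f - s₀ f) / (2 x_1)`. -/
noncomputable def del0 {n : ℕ} (hn : 2 ≤ n) (f : MvPolynomial (Fin n) ℤ) :
    MvPolynomial (Fin n) ℤ :=
  divDiffSign ⟨0, by omega⟩ f

/-- `∂₁'`, with `∂₁' f = (f - s₁ f) / (x_2 - x_1)`. -/
noncomputable def del1' {n : ℕ} (hn : 2 ≤ n) (f : MvPolynomial (Fin n) ℤ) :
    MvPolynomial (Fin n) ℤ :=
  divDiffSwap ⟨0, by omega⟩ ⟨1, by omega⟩ f

/-- `ℭ''_λ(X) = ∂₀ ∂₁' ∂₀ (Q̃_λ(X))`. -/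
noncomputable def C'' {n : ℕ} (hn : 2 ≤ n) (lam : List ℕ) : MvPolynomial (Fin n) ℤ :=
  del0 hn (del1' hn (del0 hn (Qtilde n lam)))

end LagrangianPfaffian

open LagrangianPfaffian

/-!
By `∏ (1 + x t) = (1 + x₁ t) (1 + x₂ t) ∏_{k ≥ 3} (1 + x_k t)`, the array `Q̃_{a,b}` is a part even
in `x₁` and in `x₂` plus
`x₁ x₂ (x₁ + x₂) p ∧ q + (x₁ + x₂) q ∧ r + x₁ x₂ p ∧ r`,
where `p`, `q`, `r` are the `1`-forms sending `a` to `e_{a-2}`, `e_{a-1}`, `e_a` of the remaining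
variables. A `2`-form in three `1`-forms has square zero, so adding it to an array `A` changes the
Pfaffian `Pf A` linearly: each `φ ∧ ψ` contributes the interior product `ι_φ ι_ψ Pf A`. The operator
`∂₀ ∂₁' ∂₀` extracts the coefficient of `x₁ x₂ (x₁ + x₂)`, whence `ℭ''_λ = ι_p ι_q Pf A`, and in
particular `ℭ''_{a,b} = (p ∧ q)(a, b)`. The sum of the theorem is therefore a combination of
`ι_p ι_p ι_q Pf A` and `ι_q ι_p ι_q Pf A`, and both vanish because interior products with `1`-forms
anticommute and square to zero.
-/

namespace LagrangianPfaffian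

open MvPolynomial

section Contraction

variable {ι R : Type*} [CommRing R]

/-- The interior product of a function `F` of tuples (encoded as lists) with a `1`-form `φ`:
`contract φ F l` is the sum of `(-1) ^ j * φ (l j) * F (l without its j-th entry)`, the positions
`j` being counted from `0`. It is bilinear in `φ` and `F`. -/
def contract : (ι → R) →ₗ[R] (List ι → R) →ₗ[R] (List ι → R) :=
  LinearMap.mk₂ R
    (fun φ F l => ∑ j : Fin l.length, (-1) ^ (j : ℕ) * φ l[j] * F (l.eraseIdx j))
    (fun φ ψ F => by
      ext l
      simp only [Pi.add_apply, mul_add, add_mul, Finset.sum_add_distrib])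
    (fun c φ F => by
      ext l
      simp only [Pi.smul_apply, smul_eq_mul, Finset.mul_sum]
      exact Finset.sum_congr rfl fun j _ => by ring)
    (fun φ F G => by
      ext l
      simp only [Pi.add_apply, mul_add, Finset.sum_add_distrib])
    (fun c φ F => by
      ext l
      simp only [Pi.smul_apply, smul_eq_mul, Finset.mul_sum]
      exact Finset.sum_congr rfl fun j _ => by ring)

theorem contract_apply (φ : ι → R) (F : List ι → R) (l : List ι) :
    contract φ F l = ∑ j : Fin l.length, (-1) ^ (j : ℕ) * φ l[j] * F (l.eraseIdx j) :=
  rfl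

@[simp]
theorem contract_nil (φ : ι → R) (F : List ι → R) : contract φ F [] = 0 := by
  rw [contract_apply]
  exact Fin.sum_univ_zero _

theorem contract_cons (φ : ι → R) (F : List ι → R) (a : ι) (l : List ι) :
    contract φ F (a :: l) = φ a * F l - contract φ (fun m => F (a :: m)) l := by
  simp only [contract_apply, List.length_cons, Fin.sum_univ_succ, sub_eq_add_neg,
    ← Finset.sum_neg_distrib]
  congr 1
  · simp
  · refine Finset.sum_congr rfl fun j _ => ?_
    simp [pow_succ]

theorem contract_congr_right (φ : ι → R) {F G : List ι → R} {l : List ι}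
    (h : ∀ m : List ι, m.length + 1 = l.length → F m = G m) :
    contract φ F l = contract φ G l := by
  simp only [contract_apply]
  refine Finset.sum_congr rfl fun j _ => ?_
  rw [h _ (by rw [List.length_eraseIdx_of_lt j.isLt]; have := j.isLt; omega)]

theorem contract_contract_self (φ : ι → R) (F : List ι → R) :
    contract φ (contract φ F) = 0 := by
  ext l
  induction l generalizing F with
  | nil => rw [contract_nil, Pi.zero_apply]
  | cons a l ih =>
    have hcons : (fun m => contract φ F (a :: m)) =
        φ a • F - contract φ (fun m => F (a :: m)) :=
      funext (contract_cons φ F a)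
    rw [contract_cons, hcons, map_sub, map_smul, Pi.sub_apply, ih]
    simp

theorem contract_anticomm (φ ψ : ι → R) (F : List ι → R) :
    contract φ (contract ψ F) = -contract ψ (contract φ F) := by
  have h := contract_contract_self (φ + ψ) F
  simp only [map_add, LinearMap.add_apply, contract_contract_self, zero_add, add_zero] at h
  rw [add_comm] at h
  exact eq_neg_of_add_eq_zero_left h

theorem contract_contract_cons (φ ψ : ι → R) (F : List ι → R) (a : ι) (l : List ι) :
    contract φ (contract ψ F) (a :: l) = φ a * contract ψ F l - ψ a * contract φ F l +
      contract φ (contract ψ fun m => F (a :: m)) l := by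
  have hcons : (fun m => contract ψ F (a :: m)) =
      ψ a • F - contract ψ (fun m => F (a :: m)) :=
    funext (contract_cons ψ F a)
  rw [contract_cons, hcons, map_sub, map_smul, Pi.sub_apply, Pi.smul_apply, smul_eq_mul]
  ring

theorem contract_append {φ : ι → R} {z : List ι} (hz : ∀ b ∈ z, φ b = 0) (F : List ι → R)
    (l : List ι) : contract φ F (l ++ z) = contract φ (fun m => F (m ++ z)) l := by
  induction l generalizing F with
  | nil =>
    rw [List.nil_append, contract_nil, contract_apply]
    refine Finset.sum_eq_zero fun j _ => ?_
    rw [hz z[j] (List.getElem_mem _), mul_zero, zero_mul]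
  | cons a l ih => simp only [List.cons_append, contract_cons, ih]

theorem contract_mem {S : Subring R} {φ : ι → R} (hφ : ∀ a, φ a ∈ S) {F : List ι → R}
    (hF : ∀ l, F l ∈ S) (l : List ι) : contract φ F l ∈ S := by
  rw [contract_apply]
  exact sum_mem fun j _ => mul_mem (mul_mem (pow_mem (neg_mem (one_mem S)) _) (hφ _)) (hF _)

end Contraction

section ListPfaffian

variable {ι R : Type*} [CommRing R]

/-- The Pfaffian of the array `A (l i) (l j)`, `i < j`, by expansion along the first row. Encoding
the rows as a list `l` makes the minors Pfaffians of sublists of `l`. It is `0` if `l` has odd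
length. -/
def listPfaffian (A : ι → ι → R) : List ι → R
  | [] => 1
  | a :: l => ∑ j : Fin l.length, (-1) ^ (j : ℕ) * A a l[j] * listPfaffian A (l.eraseIdx j)
termination_by l => l.length
decreasing_by grind

@[simp]
theorem listPfaffian_nil (A : ι → ι → R) : listPfaffian A [] = 1 := by
  rw [listPfaffian]

theorem listPfaffian_cons (A : ι → ι → R) (a : ι) (l : List ι) :
    listPfaffian A (a :: l) = contract (A a) (listPfaffian A) l := by
  rw [listPfaffian, contract_apply]

theorem listPfaffian_mem {S : Subring R} {A : ι → ι → R} (hA : ∀ a b, A a b ∈ S) (l : List ι) :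
    listPfaffian A l ∈ S := by
  induction hl : l.length using Nat.strong_induction_on generalizing l with
  | _ n ih =>
    cases l with
    | nil => exact listPfaffian_nil A ▸ one_mem S
    | cons a l =>
      rw [listPfaffian]
      exact sum_mem fun j _ => mul_mem (mul_mem (pow_mem (neg_mem (one_mem S)) _) (hA _ _))
        (ih _ (by subst hl; grind) _ rfl)

theorem getD_succAbove {k : ℕ} (l : List ι) (d : ι) (j : Fin (k + 1)) (i : Fin k) :
    l.getD (j.succAbove i) d = (l.eraseIdx j).getD i d := by
  simp only [List.getD_eq_getElem?_getD, List.getElem?_eraseIdx, Fin.succAbove, Fin.lt_def,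
    Fin.val_castSucc]
  split_ifs <;> rfl

theorem pfaffian_getD (A : ι → ι → R) (d : ι) (m : ℕ) (l : List ι) (hl : l.length = 2 * m) :
    pfaffian m (fun i j => A (l.getD i d) (l.getD j d)) = listPfaffian A l := by
  induction m generalizing l with
  | zero =>
    rw [List.length_eq_zero_iff.mp hl, pfaffian, listPfaffian_nil]
  | succ m ih =>
    obtain ⟨a, l, rfl⟩ := List.exists_cons_of_length_pos (l := l) (by omega)
    have hlen : 2 * m + 1 = l.length := by simpa [mul_add] using hl.symm
    rw [pfaffian, listPfaffian]
    refine Fintype.sum_equiv (finCongr hlen) _ _ fun j => ?_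
    have hj : (j : ℕ) < l.length := hlen ▸ j.isLt
    have hminor := ih (l.eraseIdx j) (by rw [List.length_eraseIdx_of_lt hj]; omega)
    simp only [Fin.val_zero, Fin.val_succ, List.getD_cons_zero, List.getD_cons_succ,
      getD_succAbove, hminor, List.getD_eq_getElem _ _ hj]
    rfl

/-- The value of the `2`-form `φ ∧ ψ` on the pair `(a, b)`. -/
def wedge (φ ψ : ι → R) (a b : ι) : R := φ a * ψ b - ψ a * φ b

theorem wedge_eq_smul_sub_smul (φ ψ : ι → R) (a : ι) : wedge φ ψ a = φ a • ψ - ψ a • φ :=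
  rfl

theorem contract_contract_listPfaffian_cons (A : ι → ι → R) (φ ψ : ι → R) (a : ι) (l : List ι) :
    contract φ (contract ψ (listPfaffian A)) (a :: l) =
      contract (wedge φ ψ a) (listPfaffian A) l +
        contract (A a) (contract φ (contract ψ (listPfaffian A))) l := by
  have hcons : (fun m => listPfaffian A (a :: m)) = contract (A a) (listPfaffian A) :=
    funext (listPfaffian_cons A a)
  have hcomm : contract φ (contract ψ (contract (A a) (listPfaffian A))) =
      contract (A a) (contract φ (contract ψ (listPfaffian A))) := by
    rw [contract_anticomm ψ, map_neg, contract_anticomm φ, neg_neg]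
  rw [contract_contract_cons, hcons, hcomm, wedge_eq_smul_sub_smul]
  simp

/-- The square of a `2`-form on a space of dimension three is zero. -/
theorem contract_wedge_contract_contract (α β γ : R) (p q r : ι → R) (F : List ι → R) (a : ι) :
    contract (α • wedge p q a + β • wedge q r a + γ • wedge p r a)
      (α • contract p (contract q F) + β • contract q (contract r F) +
        γ • contract p (contract r F)) = 0 := by
  have hxyx (x y : ι → R) : contract x (contract y (contract x F)) = 0 := by
    rw [contract_anticomm y, map_neg, contract_contract_self, neg_zero]
  have hqpr : contract q (contract p (contract r F)) = -contract p (contract q (contract r F)) :=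
    contract_anticomm q p _
  have hrpq : contract r (contract p (contract q F)) = contract p (contract q (contract r F)) := by
    rw [contract_anticomm r, contract_anticomm r, map_neg, neg_neg]
  simp only [wedge_eq_smul_sub_smul, map_add, map_sub, map_smul, LinearMap.add_apply,
    LinearMap.sub_apply, LinearMap.smul_apply, contract_contract_self, hxyx, hqpr, hrpq]
  module

/-- A `2`-form in three `1`-forms squares to zero, so only its first power contributes. -/
theorem listPfaffian_add_twoForm (A : ι → ι → R) (α β γ : R) (p q r : ι → R) :
    listPfaffian (A + (α • wedge p q + β • wedge q r + γ • wedge p r)) =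
      listPfaffian A + (α • contract p (contract q (listPfaffian A)) +
        β • contract q (contract r (listPfaffian A)) +
        γ • contract p (contract r (listPfaffian A))) := by
  ext l
  induction hl : l.length using Nat.strong_induction_on generalizing l with
  | _ n ih =>
    cases l with
    | nil => simp
    | cons a l =>
      rw [listPfaffian_cons, contract_congr_right _ fun m hm => ih m.length (by grind) m rfl]
      have hzero := congrFun
        (contract_wedge_contract_contract α β γ p q r (listPfaffian A) a) l
      simp only [Pi.add_apply, Pi.smul_apply, map_add, map_smul, LinearMap.add_apply,
        LinearMap.smul_apply, smul_eq_mul, Pi.zero_apply, listPfaffian_cons,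
        contract_contract_listPfaffian_cons] at hzero ⊢
      linear_combination hzero

end ListPfaffian

section Quadratic

variable {R : Type*} [CommRing R]

/-- The coefficients of `(1 + x t) F(t)`, where `f` lists the coefficients of `F(t)`. -/
def mulLinear (x : R) (f : ℤ → R) (k : ℤ) : R := f k + x * f (k - 1)

/-- `Q̃_{a,b}` formed from an arbitrary sequence `f` in place of the elementary symmetric
polynomials. The sum is cut off at `K`; if `f` vanishes at negative indices then every `K ≥ b`
gives the same value. -/
def quadQ (f : ℤ → R) (K : ℕ) (a b : ℤ) : R :=
  f a * f b + 2 * ∑ k ∈ Finset.Icc 1 K, (-1) ^ k * (f (a + k) * f (b - k))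

theorem quadQ_mem {S : Subring R} {f : ℤ → R} (hf : ∀ k, f k ∈ S) (K : ℕ) (a b : ℤ) :
    quadQ f K a b ∈ S :=
  add_mem (mul_mem (hf a) (hf b)) <| mul_mem (ofNat_mem S 2) <| sum_mem fun _ _ =>
    mul_mem (pow_mem (neg_mem (one_mem S)) _) (mul_mem (hf _) (hf _))

theorem sum_neg_one_pow_mul_add_succ (c : ℕ → R) (K : ℕ) :
    ∑ k ∈ Finset.Icc 1 K, (-1) ^ k * (c k + c (k + 1)) = (-1) ^ K * c (K + 1) - c 1 := by
  induction K with
  | zero => simp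
  | succ K ih =>
    rw [Finset.sum_Icc_succ_top (by omega), ih]
    ring

theorem quadQ_mulLinear {f : ℤ → R} (hf : ∀ k < 0, f k = 0) (x : R) {K : ℕ} (a : ℤ) {b : ℤ}
    (hb : b ≤ K) :
    quadQ (mulLinear x f) K a b = quadQ f K a b + x ^ 2 * quadQ f K (a - 1) (b - 1) +
      x * (f (a - 1) * f b - f a * f (b - 1)) := by
  -- The terms linear in `x` telescope.
  have htel := sum_neg_one_pow_mul_add_succ (fun k => f (a - 1 + k) * f (b - k)) K
  rw [hf (b - (K + 1 : ℕ)) (by push_cast; omega)] at htel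
  have hterm (k : ℕ) : mulLinear x f (a + k) * mulLinear x f (b - k) =
      f (a + k) * f (b - k) + x ^ 2 * (f (a - 1 + k) * f (b - 1 - k)) +
        x * (f (a - 1 + k) * f (b - k) + f (a - 1 + (k + 1 : ℕ)) * f (b - (k + 1 : ℕ))) := by
    simp only [mulLinear]
    rw [show a - 1 + ((k + 1 : ℕ) : ℤ) = a + k by push_cast; ring,
      show b - ((k + 1 : ℕ) : ℤ) = b - 1 - k by push_cast; ring,
      show a + (k : ℤ) - 1 = a - 1 + k by ring, show b - (k : ℤ) - 1 = b - 1 - k by ring]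
    ring
  simp only [quadQ, hterm, mul_add ((-1 : R) ^ _), Finset.sum_add_distrib,
    mul_left_comm ((-1 : R) ^ _) x, mul_left_comm ((-1 : R) ^ _) (x ^ 2), ← Finset.mul_sum]
  simp only [mul_add, Finset.sum_add_distrib] at htel ⊢
  simp only [mulLinear, Nat.cast_one, sub_add_cancel] at htel ⊢
  linear_combination 2 * x * htel

/-- The part of `quadQ (mulLinear x (mulLinear y f)) K a b` that is even in each of `x` and
`y`. -/
def evenQuadQ (f : ℤ → R) (x y : R) (K : ℕ) (a b : ℤ) : R :=
  quadQ f K a b + (x ^ 2 + y ^ 2) * quadQ f K (a - 1) (b - 1) +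
    x ^ 2 * y ^ 2 * quadQ f K (a - 2) (b - 2)

theorem evenQuadQ_mem {S : Subring R} {f : ℤ → R} (hf : ∀ k, f k ∈ S) {x y : R}
    (hadd : x ^ 2 + y ^ 2 ∈ S) (hmul : x ^ 2 * y ^ 2 ∈ S) (K : ℕ) (a b : ℤ) :
    evenQuadQ f x y K a b ∈ S :=
  add_mem (add_mem (quadQ_mem hf K _ _) (mul_mem hadd (quadQ_mem hf K _ _)))
    (mul_mem hmul (quadQ_mem hf K _ _))

theorem quadQ_mulLinear_mulLinear {f : ℤ → R} (hf : ∀ k < 0, f k = 0) (x y : R) {K : ℕ} (a : ℤ)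
    {b : ℤ} (hb : b ≤ K) :
    quadQ (mulLinear x (mulLinear y f)) K a b = evenQuadQ f x y K a b +
      (x * y * (x + y) * (f (a - 2) * f (b - 1) - f (a - 1) * f (b - 2)) +
        (x + y) * (f (a - 1) * f b - f a * f (b - 1)) +
        x * y * (f (a - 2) * f b - f a * f (b - 2))) := by
  have hyf : ∀ k < 0, mulLinear y f k = 0 := fun k hk => by
    rw [mulLinear, hf k hk, hf (k - 1) (by omega), mul_zero, add_zero]
  rw [quadQ_mulLinear hyf x a hb, quadQ_mulLinear hf y a hb,
    quadQ_mulLinear hf y (a - 1) (by omega), evenQuadQ]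
  simp only [mulLinear, sub_sub, Int.reduceAdd]
  ring

end Quadratic

section Esymm

variable {R : Type*} [CommRing R]

/-- The elementary symmetric functions of a multiset, extended by `0` to negative indices. -/
def esymmInt (s : Multiset R) (k : ℤ) : R := if 0 ≤ k then s.esymm k.toNat else 0

theorem esymmInt_of_neg (s : Multiset R) {k : ℤ} (hk : k < 0) : esymmInt s k = 0 :=
  if_neg (not_le.mpr hk)

theorem esymmInt_natCast (s : Multiset R) (k : ℕ) : esymmInt s k = s.esymm k := by
  simp [esymmInt]

theorem esymm_cons_succ (a : R) (s : Multiset R) (k : ℕ) :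
    (a ::ₘ s).esymm (k + 1) = s.esymm (k + 1) + a * s.esymm k := by
  simp [Multiset.esymm, Multiset.powersetCard_cons, Multiset.sum_map_mul_left]

theorem esymmInt_cons (a : R) (s : Multiset R) :
    esymmInt (a ::ₘ s) = mulLinear a (esymmInt s) := by
  ext k
  rw [mulLinear]
  rcases lt_trichotomy k 0 with hk | rfl | hk
  · simp [esymmInt_of_neg _ hk, esymmInt_of_neg s (show k - 1 < 0 by omega)]
  · simp [esymmInt, Multiset.esymm]
  · obtain ⟨m, rfl⟩ : ∃ m : ℕ, k = (m + 1 : ℕ) := ⟨k.toNat - 1, by omega⟩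
    rw [show ((m + 1 : ℕ) : ℤ) - 1 = m by push_cast; ring, esymmInt_natCast, esymmInt_natCast,
      esymmInt_natCast, esymm_cons_succ]

theorem esymmInt_mem {S : Subring R} {s : Multiset R} (hs : ∀ a ∈ s, a ∈ S) (k : ℤ) :
    esymmInt s k ∈ S := by
  rw [esymmInt]
  split_ifs
  · refine multiset_sum_mem _ fun c hc => ?_
    obtain ⟨t, ht, rfl⟩ := Multiset.mem_map.mp hc
    exact multiset_prod_mem _ fun a ha =>
      hs a (Multiset.mem_of_le (Multiset.mem_powersetCard.mp ht).1 ha)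
  · exact zero_mem S

end Esymm

section DividedDifferences

variable {σ : Type*} [DecidableEq σ] {i j : σ} {f g : MvPolynomial σ ℤ}

theorem divDiffSign_eq_of_sub_eq (h : f - signChange i f = 2 * X i * g) :
    divDiffSign i f = g := by
  rw [divDiffSign_spec] at h
  exact mul_left_cancel₀ (mul_ne_zero two_ne_zero (X_ne_zero i)) h

theorem divDiffSwap_eq_of_sub_eq (hij : i ≠ j) (h : f - swapVars i j f = (X j - X i) * g) :
    divDiffSwap i j f = g := by
  rw [divDiffSwap_spec] at h
  exact mul_left_cancel₀ (sub_ne_zero.mpr (X_injective.ne hij.symm)) h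

variable (i j) in
/-- The polynomials invariant under the sign change of `x_i` and the interchange of `x_i` and
`x_j`. The three divided differences in `∂₀ ∂₁' ∂₀` are linear over this ring. -/
noncomputable def invariantSubring : Subring (MvPolynomial σ ℤ) :=
  (signChange i).toRingHom.eqLocus (RingHom.id _) ⊓
    (swapVars i j).toRingHom.eqLocus (RingHom.id _)

theorem mem_invariantSubring :
    f ∈ invariantSubring i j ↔ signChange i f = f ∧ swapVars i j f = f :=
  Iff.rfl

theorem X_mem_invariantSubring {k : σ} (hi : k ≠ i) (hj : k ≠ j) :
    X k ∈ invariantSubring i j := by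
  simp [mem_invariantSubring, signChange, swapVars, hi, Equiv.swap_apply_of_ne_of_ne hi hj]

theorem X_sq_add_X_sq_mem_invariantSubring (hij : i ≠ j) :
    X i ^ 2 + X j ^ 2 ∈ invariantSubring i j := by
  simp [mem_invariantSubring, signChange, swapVars, hij.symm, add_comm]

theorem X_sq_mul_X_sq_mem_invariantSubring (hij : i ≠ j) :
    X i ^ 2 * X j ^ 2 ∈ invariantSubring i j := by
  simp [mem_invariantSubring, signChange, swapVars, hij.symm, mul_comm]

theorem divDiffSign_divDiffSwap_divDiffSign (hij : i ≠ j) {c₀ c₁ c₂ c₃ : MvPolynomial σ ℤ}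
    (h₀ : c₀ ∈ invariantSubring i j) (h₁ : c₁ ∈ invariantSubring i j)
    (h₂ : c₂ ∈ invariantSubring i j) (h₃ : c₃ ∈ invariantSubring i j) :
    divDiffSign i (divDiffSwap i j (divDiffSign i (c₀ + (X i * X j * (X i + X j) * c₁ +
      (X i + X j) * c₂ + X i * X j * c₃)))) = c₁ := by
  rw [mem_invariantSubring] at h₀ h₁ h₂ h₃
  have hsi : signChange i (X i) = -X i := by simp [signChange]
  have hsj : signChange i (X j) = X j := by simp [signChange, hij.symm]
  have htj : swapVars i j (X j) = X i := by simp [swapVars]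
  have hfirst : divDiffSign i (c₀ + (X i * X j * (X i + X j) * c₁ + (X i + X j) * c₂ +
      X i * X j * c₃)) = X j ^ 2 * c₁ + c₂ + X j * c₃ := by
    refine divDiffSign_eq_of_sub_eq ?_
    simp only [map_add, map_mul, hsi, hsj, h₀.1, h₁.1, h₂.1, h₃.1]
    ring
  have hsecond : divDiffSwap i j (X j ^ 2 * c₁ + c₂ + X j * c₃) = (X i + X j) * c₁ + c₃ := by
    refine divDiffSwap_eq_of_sub_eq hij ?_
    simp only [map_add, map_mul, map_pow, htj, h₁.2, h₂.2, h₃.2]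
    ring
  rw [hfirst, hsecond]
  refine divDiffSign_eq_of_sub_eq ?_
  simp only [map_add, map_mul, hsi, hsj, h₁.1, h₃.1]
  ring

end DividedDifferences

section Decomposition

section TwoVariables

variable {σ : Type*} [Fintype σ] [DecidableEq σ] (i j : σ)

/-- The elementary symmetric polynomials in all variables but `x_i` and `x_j`. -/
noncomputable def restEsymm : ℤ → MvPolynomial σ ℤ :=
  esymmInt (({i, j}ᶜ : Finset σ).val.map X)

theorem restEsymm_of_neg {k : ℤ} (hk : k < 0) : restEsymm i j k = 0 :=
  esymmInt_of_neg _ hk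

theorem restEsymm_mem_invariantSubring (k : ℤ) : restEsymm i j k ∈ invariantSubring i j := by
  refine esymmInt_mem (fun f hf => ?_) k
  obtain ⟨l, hl, rfl⟩ := Multiset.mem_map.mp hf
  have hl : l ≠ i ∧ l ≠ j := by simpa using Finset.mem_val.mp hl
  exact X_mem_invariantSubring hl.1 hl.2

variable {i j} in
theorem esymmInt_X_eq_mulLinear_restEsymm (hij : i ≠ j) :
    esymmInt ((Finset.univ : Finset σ).val.map (X (R := ℤ))) =
      mulLinear (X i) (mulLinear (X j) (restEsymm i j)) := by
  have huniv : (Finset.univ : Finset σ).val = i ::ₘ j ::ₘ ({i, j}ᶜ : Finset σ).val := by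
    rw [← Finset.insert_val_of_notMem (by simp), ← Finset.insert_val_of_notMem (by simp [hij])]
    refine congrArg Finset.val (Finset.ext fun k => ?_)
    simp only [Finset.mem_univ, Finset.mem_insert, Finset.mem_compl, Finset.mem_singleton]
    tauto
  rw [huniv, Multiset.map_cons, Multiset.map_cons, esymmInt_cons, esymmInt_cons, restEsymm]

/-- The `1`-form `a ↦ e_{a - s}` in all variables but `x_i` and `x_j`. -/
noncomputable def shiftedEsymm (s a : ℕ) : MvPolynomial σ ℤ := restEsymm i j (a - s)

theorem shiftedEsymm_zero {s : ℕ} (hs : 0 < s) : shiftedEsymm i j s 0 = 0 :=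
  restEsymm_of_neg i j (by push_cast; omega)

theorem shiftedEsymm_mem_invariantSubring (s a : ℕ) :
    shiftedEsymm i j s a ∈ invariantSubring i j :=
  restEsymm_mem_invariantSubring i j _

/-- The part of `Q̃_{a,b}` that is even in each of `x_i` and `x_j`. -/
noncomputable def evenQtilde2 (a b : ℕ) : MvPolynomial σ ℤ :=
  evenQuadQ (restEsymm i j) (X i) (X j) b a b

variable {i j} in
theorem evenQtilde2_mem_invariantSubring (hij : i ≠ j) (a b : ℕ) :
    evenQtilde2 i j a b ∈ invariantSubring i j :=
  evenQuadQ_mem (restEsymm_mem_invariantSubring i j) (X_sq_add_X_sq_mem_invariantSubring hij)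
    (X_sq_mul_X_sq_mem_invariantSubring hij) _ _ _

/-- The Pfaffian of the even parts of the `Q̃_{a,b}`, contracted with the `2`-form that accompanies
`x_i x_j (x_i + x_j)` in the decomposition of `Q̃_{a,b}`. -/
noncomputable def contractedPfaffian : List ℕ → MvPolynomial σ ℤ :=
  contract (shiftedEsymm i j 2) (contract (shiftedEsymm i j 1) (listPfaffian (evenQtilde2 i j)))

theorem contract_contractedPfaffian {s : ℕ} (hs : s = 1 ∨ s = 2) :
    contract (shiftedEsymm i j s) (contractedPfaffian i j) = 0 := by
  obtain rfl | rfl := hs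
  · rw [contractedPfaffian, contract_anticomm (shiftedEsymm i j 2), map_neg,
      contract_contract_self, neg_zero]
  · exact contract_contract_self _ _

theorem contractedPfaffian_pair (a b : ℕ) :
    contractedPfaffian i j [a, b] = wedge (shiftedEsymm i j 2) (shiftedEsymm i j 1) a b := by
  simp [contractedPfaffian, contract_cons, wedge, mul_comm]

end TwoVariables

variable {n : ℕ} {i j : Fin n}

theorem Qtilde1_eq_esymmInt (k : ℕ) :
    Qtilde1 n k = esymmInt ((Finset.univ : Finset (Fin n)).val.map (X (R := ℤ))) k := by
  rw [Qtilde1, esymm_eq_multiset_esymm, esymmInt_natCast]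

theorem Qtilde2_eq_quadQ (a b : ℕ) :
    Qtilde2 n a b =
      quadQ (esymmInt ((Finset.univ : Finset (Fin n)).val.map (X (R := ℤ)))) b a b := by
  have hsum : ∀ k ∈ Finset.Icc 1 b, (-1) ^ k * (Qtilde1 n (a + k) * Qtilde1 n (b - k)) =
      (-1) ^ k * (esymmInt ((Finset.univ : Finset (Fin n)).val.map (X (R := ℤ))) (a + k) *
        esymmInt ((Finset.univ : Finset (Fin n)).val.map (X (R := ℤ))) (b - k)) := by
    intro k hk
    rw [Qtilde1_eq_esymmInt, Qtilde1_eq_esymmInt, Nat.cast_add,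
      Nat.cast_sub (Finset.mem_Icc.mp hk).2]
  rw [Qtilde2, quadQ, Finset.sum_congr rfl hsum, Qtilde1_eq_esymmInt, Qtilde1_eq_esymmInt]

theorem Qtilde2_eq_evenQtilde2_add_twoForm (hij : i ≠ j) :
    Qtilde2 n = evenQtilde2 i j +
      ((X i * X j * (X i + X j) : MvPolynomial (Fin n) ℤ) •
          wedge (shiftedEsymm i j 2) (shiftedEsymm i j 1) +
        (X i + X j : MvPolynomial (Fin n) ℤ) • wedge (shiftedEsymm i j 1) (shiftedEsymm i j 0) +
        (X i * X j : MvPolynomial (Fin n) ℤ) •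
          wedge (shiftedEsymm i j 2) (shiftedEsymm i j 0)) := by
  ext1 a
  ext1 b
  rw [Qtilde2_eq_quadQ, esymmInt_X_eq_mulLinear_restEsymm hij,
    quadQ_mulLinear_mulLinear (fun k => restEsymm_of_neg i j) _ _ _ le_rfl]
  simp [evenQtilde2, wedge, shiftedEsymm]

theorem Qtilde_eq_listPfaffian (lam : List ℕ) :
    Qtilde n lam = listPfaffian (Qtilde2 n) (lam ++ List.replicate (lam.length % 2) 0) := by
  rw [Qtilde, ← pfaffian_getD (Qtilde2 n) 0 ((lam.length + 1) / 2) _ (by simp; omega)]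
  have hpart (k : ℕ) :
      part lam (k + 1) = (lam ++ List.replicate (lam.length % 2) 0).getD k 0 := by
    rw [part, Nat.add_sub_cancel]
    rcases lt_or_ge k lam.length with hk | hk
    · rw [List.getD_append _ _ _ _ hk]
    · rw [List.getD_eq_default _ _ hk, List.getD_append_right _ _ _ _ hk]
      simp
  simp only [hpart]

theorem C''_eq_contractedPfaffian (hn : 2 ≤ n) (lam : List ℕ) :
    C'' hn lam = contractedPfaffian (⟨0, by omega⟩ : Fin n) ⟨1, by omega⟩
      (lam ++ List.replicate (lam.length % 2) 0) := by
  set i : Fin n := ⟨0, by omega⟩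
  set j : Fin n := ⟨1, by omega⟩
  have hij : i ≠ j := by simp [i, j]
  have hpf (l) : listPfaffian (evenQtilde2 i j) l ∈ invariantSubring i j :=
    listPfaffian_mem (evenQtilde2_mem_invariantSubring hij) l
  have hcontract (s t l) : contract (shiftedEsymm i j s) (contract (shiftedEsymm i j t)
      (listPfaffian (evenQtilde2 i j))) l ∈ invariantSubring i j :=
    contract_mem (shiftedEsymm_mem_invariantSubring i j s)
      (contract_mem (shiftedEsymm_mem_invariantSubring i j t) hpf) l
  rw [C'', Qtilde_eq_listPfaffian, Qtilde2_eq_evenQtilde2_add_twoForm hij,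
    listPfaffian_add_twoForm]
  exact divDiffSign_divDiffSwap_divDiffSign hij (hpf _) (hcontract 2 1 _) (hcontract 1 0 _)
    (hcontract 2 0 _)

end Decomposition

section AppendSingleton

theorem remove_append_singleton_pair {l : List ℕ} {b : ℕ} (h : (l ++ [b]).Nodup)
    (j : Fin l.length) : remove (l ++ [b]) [l[j], b] = l.eraseIdx j := by
  obtain ⟨hl, hb⟩ : l.Nodup ∧ ∀ a ∈ l, a ≠ b := by simpa [List.nodup_append] using h
  rw [← hl.erase_getElem j j.isLt, hl.erase_eq_filter, remove, List.filter_append]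
  have hlast : [b].filter (fun a => a ∉ [l[j], b]) = [] := by simp
  rw [hlast, List.append_nil]
  refine List.filter_congr fun a ha => ?_
  simp [hb a ha, bne, beq_eq_decide]

theorem part_append_singleton_succ (l : List ℕ) (b : ℕ) (j : Fin l.length) :
    part (l ++ [b]) (j + 1) = l[j] := by
  simp [part]

theorem part_append_singleton_length (l : List ℕ) (b : ℕ) :
    part (l ++ [b]) (l ++ [b]).length = b := by
  simp [part]

end AppendSingleton

section VanishingSum

variable {n : ℕ} (hn : 2 ≤ n)

theorem contract_C''_eq_zero {s : ℕ} (hs : s = 1 ∨ s = 2) (l : List ℕ) :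
    contract (shiftedEsymm (⟨0, by omega⟩ : Fin n) ⟨1, by omega⟩ s) (C'' hn) l = 0 := by
  set z : List ℕ := List.replicate ((l.length - 1) % 2) 0
  have hz : ∀ b ∈ z, shiftedEsymm (⟨0, by omega⟩ : Fin n) ⟨1, by omega⟩ s b = 0 := by
    intro b hb
    rw [List.eq_of_mem_replicate hb]
    exact shiftedEsymm_zero _ _ (by omega)
  rw [contract_congr_right _ fun m hm => ?_, ← contract_append hz,
    contract_contractedPfaffian _ _ hs, Pi.zero_apply]
  rw [C''_eq_contractedPfaffian, show m.length = l.length - 1 by omega]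

theorem sum_C''_pair_mul_C''_eraseIdx (l : List ℕ) (b : ℕ) :
    ∑ j : Fin l.length, (-1) ^ (j : ℕ) * C'' hn [l[j], b] * C'' hn (l.eraseIdx j) = 0 := by
  set p := shiftedEsymm (⟨0, by omega⟩ : Fin n) ⟨1, by omega⟩ 2
  set q := shiftedEsymm (⟨0, by omega⟩ : Fin n) ⟨1, by omega⟩ 1
  have hpair (a : ℕ) : C'' hn [a, b] = (q b • p - p b • q) a := by
    rw [C''_eq_contractedPfaffian]
    simpa [wedge, mul_comm] using contractedPfaffian_pair _ _ a b
  calc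
    _ = contract (q b • p - p b • q) (C'' hn) l := by simp only [hpair, contract_apply]
    _ = q b * contract p (C'' hn) l - p b * contract q (C'' hn) l := by simp
    _ = 0 := by
      rw [contract_C''_eq_zero hn (.inr rfl), contract_C''_eq_zero hn (.inl rfl)]
      ring

end VanishingSum

end LagrangianPfaffian

theorem mainTheorem4_general (n : ℕ) (hn : 2 ≤ n) (lam : List ℕ) (hlam : lam.Nodup) :
    ∑ j ∈ Finset.Icc 1 (lam.length - 1),
      (-1) ^ (j - 1) * C'' hn [part lam j, part lam lam.length] *
        C'' hn (remove lam [part lam j, part lam lam.length]) = 0 := by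
  obtain rfl | ⟨l, b, rfl⟩ := lam.eq_nil_or_concat'
  · rfl
  have hIcc : Finset.Icc 1 ((l ++ [b]).length - 1) = (Finset.range l.length).image (· + 1) := by
    ext k
    simp only [List.length_append, List.length_singleton, Finset.mem_Icc, Finset.mem_image,
      Finset.mem_range]
    exact ⟨fun hk => ⟨k - 1, by omega⟩, fun ⟨j, hj, hjk⟩ => by omega⟩
  rw [hIcc, Finset.sum_image (add_left_injective 1).injOn, Finset.sum_range,
    ← sum_C''_pair_mul_C''_eraseIdx hn l b]
  refine Finset.sum_congr rfl fun j _ => ?_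
  rw [Nat.add_sub_cancel, part_append_singleton_succ, part_append_singleton_length,
    remove_append_singleton_pair hlam]

theorem mainTheorem4 (n : ℕ) (hn : 2 ≤ n) (lam : List ℕ) (hlam : IsStrictPartition n lam)
    (heven : Even lam.length) (hlen : 4 ≤ lam.length) :
    ∑ j ∈ Finset.Icc 1 (lam.length - 1),
      (-1) ^ (j - 1) * C'' hn [part lam j, part lam lam.length] *
        C'' hn (remove lam [part lam j, part lam lam.length]) = 0 :=
  mainTheorem4_general n hn lam (hlam.1.imp ne_of_gt)
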